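/- Let $k$ be an algebraically closed field and let $\mathcal H$ be a hereditary category over $k$, that is, a connected abelian $k$-linear category in which $\mathrm{Ext}^2_{\mathcal H}(X,Y)=0$ and in which $\mathrm{Hom}_{\mathcal H}(X,Y)$ and $\mathrm{Ext}^1_{\mathcal H}(X,Y)$ are finite dimensional over $k$, for all $X,Y\in\mathcal H$. Full subcategories are understood to be closed under isomorphisms. Identify $\mathcal H$ with the full subcategory of complexes concentrated in degree $0$ of the bounded derived category $\mathcal D^b(\mathcal H)$, and for a full subcategory $\mathcal U$ of $\mathcal D^b(\mathcal H)$ put $\mathcal U^\perp=\{Y \mid \mathrm{Hom}(X,Y)=0 \text{ for all } X\in\mathcal U\}$. A torsion pair in $\mathcal H$ is a pair $(\mathcal T,\mathcal F)$ of full subcategories of $\mathcal H$ such that $\mathrm{Hom}_{\mathcal H}(X,Y)=0$ for all $X\in\mathcal T$, $Y\in\mathcal F$, and such that every $Y\in\mathcal H$ has a short exact sequence $0\to X\to Y\to Z\to 0$ with $X\in\mathcal T$, $Z\in\mathcal F$. Every t-structure in $\mathcal D^b(\mathcal H)$ has the form $(\mathcal U,\mathcal U^\perp[1])$, where $\mathcal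 U$ is its aisle. Then the following two maps are well defined, and they are mutually inverse bijections between the class of all torsion pairs $(\mathcal T,\mathcal F)$ in $\mathcal H$ and the class of all t-structures $(\mathcal U,\mathcal U^\perp[1])$ in $\mathcal D^b(\mathcal H)$ such that $\mathcal H[1]\subseteq\mathcal U$ and $\mathcal H[-1]\subseteq\mathcal U^\perp$: - the lift map, sending $(\mathcal T,\mathcal F)$ to the t-structure $(\mathcal U_{\mathcal T},\mathcal U_{\mathcal T}^\perp[1])$ with $$\mathcal U_{\mathcal T}=\{X \mid H^i(X)=0 \text{ for all } i>0,\ H^0(X)\in\mathcal T\},\qquad \mathcal U_{\mathcal T}^\perp[1]=\{X \mid H^i(X)=0 \text{ for all } i<-1,\ H^{-1}(X)\in\mathcal F\};$$ - the trace map, sending $(\mathcal U,\mathcal U^\perp[1])$ to the torsion pair $(\mathcal U\cap\mathcal H,\ \mathcal U^\perp\cap\mathcal H)$. -/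

import Mathlib

open CategoryTheory CategoryTheory.Limits CategoryTheory.Triangulated

universe w' w v u t

namespace TorsionTilt

/-- An additive category is connected if it is not the direct sum of two nonzero full
subcategories: whenever `P` and `Q` are classes of objects without nonzero morphisms between
them, in either direction, such that every object is a direct sum of an object of `P` and an
object of `Q`, one of the two classes consists of zero objects only. -/
def IsConnectedAdditive (H : Type u) [Category.{v} H] [Abelian H] : Prop :=
  ∀ P Q : ObjectProperty H,
    (∀ X Y : H, P X → Q Y → ∀ f : X ⟶ Y, f = 0) →
    (∀ X Y : H, P X → Q Y → ∀ f : Y ⟶ X, f = 0) →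
    (∀ Z : H, ∃ X Y : H, P X ∧ Q Y ∧ Nonempty (Z ≅ X ⊞ Y)) →
    (∀ X : H, P X → IsZero X) ∨ (∀ Y : H, Q Y → IsZero Y)

/-- A hereditary category over `k`: a connected abelian `k`-linear category in which `Ext²`
vanishes and in which the spaces `Hom` and `Ext¹` are finite dimensional. -/
structure IsHereditary (k : Type t) [Field k] (H : Type u) [Category.{v} H] [Abelian H]
    [Linear k H] [HasExt.{w'} H] : Prop where
  connected : IsConnectedAdditive H
  ext_two_eq_zero : ∀ (X Y : H) (e : Abelian.Ext.{w'} X Y 2), e = 0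
  finite_hom : ∀ X Y : H, Module.Finite k (X ⟶ Y)
  finite_ext_one : ∀ X Y : H, Module.Finite k (Abelian.Ext.{w'} X Y 1)

/-- A torsion pair `(𝒯, ℱ)` in an abelian category. Full subcategories are given by classes of
objects that are closed under isomorphisms. -/
@[ext]
structure TorsionPair (H : Type u) [Category.{v} H] [Abelian H] where
  /-- the torsion objects -/
  torsion : ObjectProperty H
  /-- the torsion-free objects -/
  torsionFree : ObjectProperty H
  torsion_of_iso : torsion.IsClosedUnderIsomorphisms
  torsionFree_of_iso : torsionFree.IsClosedUnderIsomorphisms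
  hom_eq_zero : ∀ ⦃X Y : H⦄, torsion X → torsionFree Y → ∀ f : X ⟶ Y, f = 0
  exists_shortExact : ∀ Y : H, ∃ (X Z : H) (f : X ⟶ Y) (g : Y ⟶ Z) (zero : f ≫ g = 0),
    torsion X ∧ torsionFree Z ∧ (ShortComplex.mk f g zero).ShortExact

variable {H : Type u} [Category.{v} H] [Abelian H] [HasDerivedCategory.{w} H]

/-- An object `M` of `H`, seen in the bounded derived category as a complex concentrated in
degree `0`. -/
noncomputable def stalk (M : H) : DerivedCategory.Bounded H :=
  ⟨(DerivedCategory.singleFunctor H 0).obj M, ⟨0, inferInstance⟩, ⟨0, inferInstance⟩⟩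

/-- The cohomology object `Hⁱ(X)` of an object `X` of the bounded derived category. -/
noncomputable def coho (i : ℤ) (X : DerivedCategory.Bounded H) : H :=
  (DerivedCategory.homologyFunctor H i).obj X.obj

/-- The objects `X` with `Hⁱ(X) = 0` for `i > 0` and `H⁰(X) ∈ 𝒯`. -/
def liftAisle (τ : TorsionPair H) : ObjectProperty (DerivedCategory.Bounded H) :=
  fun X => (∀ i : ℤ, 0 < i → IsZero (coho i X)) ∧ τ.torsion (coho 0 X)

/-- The objects `X` with `Hⁱ(X) = 0` for `i < -1` and `H⁻¹(X) ∈ ℱ`. -/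
def liftCoaisle (τ : TorsionPair H) : ObjectProperty (DerivedCategory.Bounded H) :=
  fun X => (∀ i : ℤ, i < -1 → IsZero (coho i X)) ∧ τ.torsionFree (coho (-1) X)

/-- The t-structure `s`, that is, the pair `(𝒰, 𝒱) = (s.le 0, s.ge 0)`, is the lift of the
torsion pair `τ`. -/
structure IsLift (τ : TorsionPair H) (s : TStructure (DerivedCategory.Bounded H)) : Prop where
  le_zero_eq : s.le 0 = liftAisle τ
  ge_zero_eq : s.ge 0 = liftCoaisle τ

/-- The torsion pair `τ` is the trace `(𝒰 ∩ H, 𝒰^⊥ ∩ H)` of the t-structure `s`, where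
`𝒰 = s.le 0`. -/
structure IsTrace (s : TStructure (DerivedCategory.Bounded H)) (τ : TorsionPair H) : Prop where
  torsion_iff : ∀ M : H, τ.torsion M ↔ s.le 0 (stalk M)
  torsionFree_iff : ∀ M : H, τ.torsionFree M ↔ (s.le 0).rightOrthogonal (stalk M)

/-- The conditions `H[1] ⊆ 𝒰` and `H[-1] ⊆ 𝒰^⊥` on a t-structure with aisle `𝒰 = s.le 0`. -/
structure IsIntermediate (s : TStructure (DerivedCategory.Bounded H)) : Prop where
  shift_one_mem : ∀ M : H, s.le 0 ((stalk M)⟦(1 : ℤ)⟧)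
  shift_neg_one_mem : ∀ M : H, (s.le 0).rightOrthogonal ((stalk M)⟦(-1 : ℤ)⟧)

end TorsionTilt

/-! Truncation for the canonical t-structure reduces everything to the single degree `0`. Given a
torsion pair, take `A = τ^{≤0} X` and let `U` be the fibre of `A → H⁰(A) → Z`, where `Z` is the
torsion-free quotient of `H⁰(A)`. This is the truncation triangle of the lifted t-structure
(`exists_triangle_liftAisle_liftCoaisle`). Conversely, an intermediate t-structure satisfies
`D^{≤-1} ⊆ 𝒰 ⊆ D^{≤0}` and dually (`le_zero_of_isLE`, `ge_one_of_isGE` and orthogonality). Hence the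
truncation triangle of an object of `H` has all its terms in `H` and is a short exact sequence. The
sandwich also shows that membership in `𝒰` and `𝒰^⊥` is decided by `H⁰`, so that lift and trace are
inverse to each other. -/

open Pretriangulated

/-! ### Generalities on distinguished triangles and t-structures. -/

namespace CategoryTheory

variable {C : Type*} [Category* C] [Preadditive C] [HasZeroObject C] [HasShift C ℤ]
  [∀ (n : ℤ), (shiftFunctor C n).Additive] [Pretriangulated C]

namespace Pretriangulated

lemma distinguished_of_iso₁ {X Y Z X' : C} {f : X ⟶ Y} {g : Y ⟶ Z} {h : Z ⟶ X⟦(1 : ℤ)⟧}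
    (hT : Triangle.mk f g h ∈ distTriang C) (a : X ≅ X') :
    Triangle.mk (a.inv ≫ f) g (h ≫ a.hom⟦(1 : ℤ)⟧') ∈ distTriang C := by
  refine isomorphic_distinguished _ hT _
    (Triangle.isoMk _ _ a.symm (Iso.refl _) (Iso.refl _) ?_ ?_ ?_)
  all_goals dsimp
  · exact Category.comp_id _
  · exact (Category.comp_id _).trans (Category.id_comp _).symm
  · exact (Category.assoc _ _ _).trans (((congrArg (h ≫ ·)
      ((shiftFunctor C (1 : ℤ)).mapIso a).hom_inv_id).trans
      (Category.comp_id _)).trans (Category.id_comp _).symm)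

lemma distinguished_of_iso₃ {X Y Z Z' : C} {f : X ⟶ Y} {g : Y ⟶ Z} {h : Z ⟶ X⟦(1 : ℤ)⟧}
    (hT : Triangle.mk f g h ∈ distTriang C) (a : Z ≅ Z') :
    Triangle.mk f (g ≫ a.hom) (a.inv ≫ h) ∈ distTriang C := by
  refine isomorphic_distinguished _ hT _
    (Triangle.isoMk _ _ (Iso.refl _) (Iso.refl _) a.symm ?_ ?_ ?_)
  all_goals dsimp
  · exact (Category.comp_id _).trans (Category.id_comp _).symm
  · exact (Category.assoc _ _ _).trans (((congrArg (g ≫ ·) a.hom_inv_id).trans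
      (Category.comp_id _)).trans (Category.id_comp _).symm)
  · exact (congrArg ((a.inv ≫ h) ≫ ·) ((shiftFunctor C (1 : ℤ)).map_id X)).trans
      (Category.comp_id _)

end Pretriangulated

namespace Triangulated.TStructure

lemma rightOrthogonal_le_eq_ge (s : TStructure C) (n₀ n₁ : ℤ) (h : n₀ + 1 = n₁) :
    (s.le n₀).rightOrthogonal = s.ge n₁ := by
  ext Y
  rw [ge_iff_isGE, s.isGE_iff_orthogonal n₀ n₁ h, ObjectProperty.rightOrthogonal_iff]
  exact ⟨fun hY X f hX => hY f hX.le, fun hY X f hX => hY X f ⟨hX⟩⟩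

/-- The two halves are each other's orthogonals, so the inclusion of coaisles reverses to the
missing inclusion of aisles. Shifting then settles every degree. -/
lemma ext_of_le_zero_of_ge_one {s s' : TStructure C} (hle : s.le 0 ≤ s'.le 0)
    (hge : s.ge 1 ≤ s'.ge 1) : s = s' := by
  have hle' : s.le 0 = s'.le 0 := by
    refine le_antisymm hle fun X hX => ?_
    rw [le_iff_isLE, s.isLE_iff_orthogonal 0 1 rfl]
    exact fun Y f hY => s'.zero' f hX (hge _ hY.ge)
  have hge' : s.ge 1 = s'.ge 1 := by
    rw [← rightOrthogonal_le_eq_ge s 0 1 rfl, ← rightOrthogonal_le_eq_ge s' 0 1 rfl, hle']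
  have h₁ : s.le = s'.le := by
    ext n : 1
    rw [← s.shift_le n 0 n (add_zero n), ← s'.shift_le n 0 n (add_zero n), hle']
  have h₂ : s.ge = s'.ge := by
    ext n : 1
    rw [← s.shift_ge (n - 1) 1 n (by lia), ← s'.shift_ge (n - 1) 1 n (by lia), hge']
  cases s
  cases s'
  cases h₁
  cases h₂
  rfl

end Triangulated.TStructure

end CategoryTheory

/-! ### Stalk complexes and cohomology in the bounded derived category. -/

namespace TorsionTilt

namespace TorsionPair

variable {H : Type u} [Category.{v} H] [Abelian H] (τ : TorsionPair H)

instance : τ.torsion.IsClosedUnderIsomorphisms := τ.torsion_of_iso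

instance : τ.torsionFree.IsClosedUnderIsomorphisms := τ.torsionFree_of_iso

lemma torsion_of_isZero {X : H} (hX : IsZero X) : τ.torsion X := by
  obtain ⟨A, B, f, g, zero, hA, -, h⟩ := τ.exists_shortExact X
  have := h.mono_f
  exact τ.torsion.prop_of_iso ((IsZero.of_mono f hX).iso hX) hA

lemma torsionFree_of_isZero {X : H} (hX : IsZero X) : τ.torsionFree X := by
  obtain ⟨A, B, f, g, zero, -, hB, h⟩ := τ.exists_shortExact X
  have := h.epi_g
  exact τ.torsionFree.prop_of_iso ((IsZero.of_epi g hX).iso hX) hB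

end TorsionPair

section

variable (H : Type u) [Category.{v} H] [Abelian H] [HasDerivedCategory.{w} H]

/-- The canonical t-structure on the bounded derived category. -/
noncomputable abbrev tCan : TStructure (DerivedCategory.Bounded H) :=
  (DerivedCategory.TStructure.t (C := H)).onBounded

/-- The functor `Hⁱ` on the bounded derived category. -/
noncomputable abbrev cohoFunctor (i : ℤ) : DerivedCategory.Bounded H ⥤ H :=
  DerivedCategory.Bounded.ι ⋙ DerivedCategory.homologyFunctor H i

/-- The embedding of `H` in its bounded derived category. -/
noncomputable abbrev stalkFunctor : H ⥤ DerivedCategory.Bounded H :=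
  ObjectProperty.lift _ (DerivedCategory.singleFunctor H 0) (fun M => (stalk M).property)

instance : (stalkFunctor H).Faithful where
  map_injective h := (DerivedCategory.singleFunctor H 0).map_injective
    (congrArg DerivedCategory.Bounded.ι.map h)

instance : (stalkFunctor H).Full where
  map_surjective f := by
    obtain ⟨g, hg⟩ := (DerivedCategory.singleFunctor H 0).map_surjective
      (DerivedCategory.Bounded.ι.map f)
    exact ⟨g, DerivedCategory.Bounded.ι.map_injective hg⟩

instance : (stalkFunctor H).PreservesZeroMorphisms where
  map_zero _ _ := DerivedCategory.Bounded.ι.map_injective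
    ((DerivedCategory.singleFunctor H 0).map_zero _ _)

end

variable {H : Type u} [Category.{v} H] [Abelian H] [HasDerivedCategory.{w} H]

lemma isLE_iff_isZero_coho (X : DerivedCategory.Bounded H) (n : ℤ) :
    (tCan H).IsLE X n ↔ ∀ i : ℤ, n < i → IsZero (coho i X) := by
  rw [ObjectProperty.tStructure_isLE_iff]
  exact DerivedCategory.isLE_iff X.obj n

lemma isGE_iff_isZero_coho (X : DerivedCategory.Bounded H) (n : ℤ) :
    (tCan H).IsGE X n ↔ ∀ i : ℤ, i < n → IsZero (coho i X) := by
  rw [ObjectProperty.tStructure_isGE_iff]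
  exact DerivedCategory.isGE_iff X.obj n

instance (M : H) : (tCan H).IsLE (stalk M) 0 := by
  rw [ObjectProperty.tStructure_isLE_iff]
  dsimp [stalk]
  infer_instance

instance (M : H) : (tCan H).IsGE (stalk M) 0 := by
  rw [ObjectProperty.tStructure_isGE_iff]
  dsimp [stalk]
  infer_instance

lemma exists_isGE (X : DerivedCategory.Bounded H) : ∃ n : ℤ, (tCan H).IsGE X n := by
  obtain ⟨n, hn⟩ := X.property.1
  exact ⟨n, (ObjectProperty.tStructure_isGE_iff _ _ X n).2 hn⟩

lemma exists_isLE (X : DerivedCategory.Bounded H) : ∃ n : ℤ, (tCan H).IsLE X n := by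
  obtain ⟨n, hn⟩ := X.property.2
  exact ⟨n, (ObjectProperty.tStructure_isLE_iff _ _ X n).2 hn⟩

/-- `H⁰` of a stalk complex. -/
noncomputable def cohoStalkIso (M : H) : coho 0 (stalk M) ≅ M :=
  (DerivedCategory.singleFunctorCompHomologyFunctorIso H 0).app M

/-- `Hⁱ` of a shift. -/
noncomputable def cohoShiftIso (X : DerivedCategory.Bounded H) (n i j : ℤ) (h : n + i = j) :
    coho i (X⟦n⟧) ≅ coho j X :=
  (DerivedCategory.homologyFunctor H i).mapIso
      ((DerivedCategory.Bounded.ι.commShiftIso n).app X) ≪≫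
    ((DerivedCategory.homologyFunctor H 0).shiftIso n i j h).app X.obj

lemma exists_iso_stalk (X : DerivedCategory.Bounded H) [h₁ : (tCan H).IsLE X 0]
    [h₂ : (tCan H).IsGE X 0] : ∃ M : H, Nonempty (X ≅ stalk M) := by
  rw [ObjectProperty.tStructure_isLE_iff] at h₁
  rw [ObjectProperty.tStructure_isGE_iff] at h₂
  obtain ⟨M, ⟨e⟩⟩ := X.obj.exists_iso_singleFunctor_obj_of_isGE_of_isLE 0
  exact ⟨M, ⟨ObjectProperty.isoMk _ e⟩⟩

lemma coho_exact₂ (T : Triangle (DerivedCategory.Bounded H)) (hT : T ∈ distTriang _) (n : ℤ) :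
    (ShortComplex.mk ((cohoFunctor H n).map T.mor₁) ((cohoFunctor H n).map T.mor₂)
      (by rw [← Functor.map_comp, comp_distTriang_mor_zero₁₂ _ hT, Functor.map_zero])).Exact :=
  DerivedCategory.HomologySequence.exact₂ _
    (DerivedCategory.Bounded.ι.map_distinguished _ hT) n

lemma mono_coho_map_mor₁ (T : Triangle (DerivedCategory.Bounded H)) (hT : T ∈ distTriang _)
    (n₀ n₁ : ℤ) (h : n₀ + 1 = n₁) (h₃ : IsZero (coho n₀ T.obj₃)) :
    Mono ((cohoFunctor H n₁).map T.mor₁) :=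
  (DerivedCategory.HomologySequence.mono_homologyMap_mor₁_iff _
    (DerivedCategory.Bounded.ι.map_distinguished _ hT) n₀ n₁ h).2 (h₃.eq_of_src _ _)

lemma epi_coho_map_mor₂ (T : Triangle (DerivedCategory.Bounded H)) (hT : T ∈ distTriang _)
    (n₀ n₁ : ℤ) (h : n₀ + 1 = n₁) (h₁ : IsZero (coho n₁ T.obj₁)) :
    Epi ((cohoFunctor H n₀).map T.mor₂) :=
  (DerivedCategory.HomologySequence.epi_homologyMap_mor₂_iff _
    (DerivedCategory.Bounded.ι.map_distinguished _ hT) n₀ n₁ h).2 (h₁.eq_of_tgt _ _)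

lemma mono_coho_map_mor₂ (T : Triangle (DerivedCategory.Bounded H)) (hT : T ∈ distTriang _)
    (n : ℤ) (h₁ : IsZero (coho n T.obj₁)) : Mono ((cohoFunctor H n).map T.mor₂) :=
  (DerivedCategory.HomologySequence.mono_homologyMap_mor₂_iff _
    (DerivedCategory.Bounded.ι.map_distinguished _ hT) n).2 (h₁.eq_of_src _ _)

lemma epi_coho_map_mor₁ (T : Triangle (DerivedCategory.Bounded H)) (hT : T ∈ distTriang _)
    (n : ℤ) (h₃ : IsZero (coho n T.obj₃)) : Epi ((cohoFunctor H n).map T.mor₁) :=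
  (DerivedCategory.HomologySequence.epi_homologyMap_mor₁_iff _
    (DerivedCategory.Bounded.ι.map_distinguished _ hT) n).2 (h₃.eq_of_tgt _ _)

lemma nonempty_coho_iso_of_isLE (T : Triangle (DerivedCategory.Bounded H))
    (hT : T ∈ distTriang _) (n₀ n₁ : ℤ) (h : n₀ + 1 = n₁) (h₁ : (tCan H).IsLE T.obj₁ n₀) :
    Nonempty (coho n₁ T.obj₂ ≅ coho n₁ T.obj₃) := by
  rw [isLE_iff_isZero_coho] at h₁
  have := mono_coho_map_mor₂ T hT n₁ (h₁ n₁ (by lia))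
  have := epi_coho_map_mor₂ T hT n₁ (n₁ + 1) rfl (h₁ (n₁ + 1) (by lia))
  have := isIso_of_mono_of_epi ((cohoFunctor H n₁).map T.mor₂)
  let e := asIso ((cohoFunctor H n₁).map T.mor₂)
  exact ⟨e⟩

lemma nonempty_coho_iso_of_isGE (T : Triangle (DerivedCategory.Bounded H))
    (hT : T ∈ distTriang _) (n₀ n₁ : ℤ) (h : n₀ + 1 = n₁) (h₃ : (tCan H).IsGE T.obj₃ n₁) :
    Nonempty (coho n₀ T.obj₁ ≅ coho n₀ T.obj₂) := by
  rw [isGE_iff_isZero_coho] at h₃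
  have := mono_coho_map_mor₁ T hT (n₀ - 1) n₀ (by lia) (h₃ (n₀ - 1) (by lia))
  have := epi_coho_map_mor₁ T hT n₀ (h₃ n₀ (by lia))
  have := isIso_of_mono_of_epi ((cohoFunctor H n₀).map T.mor₁)
  let e := asIso ((cohoFunctor H n₀).map T.mor₁)
  exact ⟨e⟩

/-- An object of `D^{≤ 0}` is an extension of its `H⁰` by an object of `D^{≤ -1}`. -/
lemma exists_triangle_of_isLE_zero (X : DerivedCategory.Bounded H) [(tCan H).IsLE X 0] :
    ∃ (C : DerivedCategory.Bounded H) (f : C ⟶ X) (g : X ⟶ stalk (coho 0 X))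
      (h : stalk (coho 0 X) ⟶ C⟦(1 : ℤ)⟧), (tCan H).IsLE C (-1) ∧
        Triangle.mk f g h ∈ distTriang _ := by
  obtain ⟨C, S, hC, hS, f, g, h, hT⟩ := (tCan H).exists_triangle X (-1) 0 rfl
  have hC' : (tCan H).IsLE C (-1) := ⟨hC⟩
  have : (tCan H).IsGE S 0 := ⟨hS⟩
  have : (tCan H).IsLE S 0 := by
    have := (tCan H).isLE_shift C (-1) 1 (-2)
    exact (tCan H).isLE₂ _ (rot_of_distTriang _ hT) 0 ‹_›
      ((tCan H).isLE_of_le (C⟦(1 : ℤ)⟧) (-2) 0)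
  obtain ⟨M, ⟨e⟩⟩ := exists_iso_stalk S
  obtain ⟨e'⟩ := nonempty_coho_iso_of_isLE _ hT (-1) 0 rfl hC'
  let a : S ≅ stalk (coho 0 X) := e ≪≫ (stalkFunctor H).mapIso
    ((cohoStalkIso M).symm ≪≫ (cohoFunctor H 0).mapIso e.symm ≪≫ e'.symm)
  exact ⟨C, f, g ≫ a.hom, a.inv ≫ h, hC', distinguished_of_iso₃ hT a⟩

/-- An object of `D^{≥ 0}` is an extension of an object of `D^{≥ 1}` by its `H⁰`. -/
lemma exists_triangle_of_isGE_zero (X : DerivedCategory.Bounded H) [(tCan H).IsGE X 0] :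
    ∃ (C : DerivedCategory.Bounded H) (f : stalk (coho 0 X) ⟶ X) (g : X ⟶ C)
      (h : C ⟶ (stalk (coho 0 X))⟦(1 : ℤ)⟧), (tCan H).IsGE C 1 ∧
        Triangle.mk f g h ∈ distTriang _ := by
  obtain ⟨S, C, hS, hC, f, g, h, hT⟩ := (tCan H).exists_triangle X 0 1 rfl
  have hC' : (tCan H).IsGE C 1 := ⟨hC⟩
  have : (tCan H).IsLE S 0 := ⟨hS⟩
  have : (tCan H).IsGE S 0 := by
    have := (tCan H).isGE_shift C 1 (-1) 2
    exact (tCan H).isGE₂ _ (inv_rot_of_distTriang _ hT) 0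
      ((tCan H).isGE_of_ge (C⟦(-1 : ℤ)⟧) 0 2) ‹_›
  obtain ⟨M, ⟨e⟩⟩ := exists_iso_stalk S
  obtain ⟨e'⟩ := nonempty_coho_iso_of_isGE _ hT 0 1 rfl hC'
  let a : S ≅ stalk (coho 0 X) := e ≪≫ (stalkFunctor H).mapIso
    ((cohoStalkIso M).symm ≪≫ (cohoFunctor H 0).mapIso e.symm ≪≫ e')
  exact ⟨C, a.inv ≫ f, g, h ≫ a.hom⟦(1 : ℤ)⟧', hC', distinguished_of_iso₁ hT a⟩

lemma exists_distinguished_stalk (S : ShortComplex H) (hS : S.ShortExact) :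
    ∃ h : stalk S.X₃ ⟶ (stalk S.X₁)⟦(1 : ℤ)⟧,
      Triangle.mk ((stalkFunctor H).map S.f) ((stalkFunctor H).map S.g) h ∈ distTriang _ := by
  -- The shift in the target of `singleδ` is taken in the unbounded derived category; `commShiftIso`
  -- moves it to the bounded one.
  refine ⟨ObjectProperty.homMk (hS.singleδ ≫
    (DerivedCategory.Bounded.ι.commShiftIso (1 : ℤ)).inv.app (stalk S.X₁)), ?_⟩
  refine isomorphic_distinguished _ hS.singleTriangle_distinguished _
    (Triangle.isoMk _ _ (Iso.refl _) (Iso.refl _) (Iso.refl _) ?_ ?_ ?_)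
  · exact (Category.comp_id _).trans (Category.id_comp _).symm
  · exact (Category.comp_id _).trans (Category.id_comp _).symm
  · refine Eq.trans ?_ (Category.id_comp _).symm
    refine (congrArg (_ ≫ ·) ((shiftFunctor _ (1 : ℤ)).map_id _)).trans
      ((Category.comp_id _).trans ?_)
    exact (Category.assoc _ _ _).trans ((congrArg (hS.singleδ ≫ ·)
      ((DerivedCategory.Bounded.ι.commShiftIso (1 : ℤ)).inv_hom_id_app (stalk S.X₁))).trans
      (Category.comp_id _))

/-- The maps come from `H` by full faithfulness. Exactness is the long cohomology sequence in degree
`0`, bounded by `H⁻¹` of `stalk Z` and `H¹` of `stalk X`, which vanish. -/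
lemma exists_shortExact_of_distinguished_stalk {X Y Z : H} (a : stalk X ⟶ stalk Y)
    (b : stalk Y ⟶ stalk Z) (c : stalk Z ⟶ (stalk X)⟦(1 : ℤ)⟧)
    (hT : Triangle.mk a b c ∈ distTriang _) :
    ∃ (f : X ⟶ Y) (g : Y ⟶ Z) (zero : f ≫ g = 0), (ShortComplex.mk f g zero).ShortExact := by
  obtain ⟨f, rfl⟩ := (stalkFunctor H).map_surjective a
  obtain ⟨g, rfl⟩ := (stalkFunctor H).map_surjective b
  have zero : f ≫ g = 0 := (stalkFunctor H).map_injective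
    (((stalkFunctor H).map_comp f g).trans ((comp_distTriang_mor_zero₁₂ _ hT).trans
      ((stalkFunctor H).map_zero _ _).symm))
  have hX := (isLE_iff_isZero_coho (stalk X) 0).1 inferInstance 1 (by lia)
  have hZ := (isGE_iff_isZero_coho (stalk Z) 0).1 inferInstance (-1) (by lia)
  have hS := ShortComplex.ShortExact.mk' (coho_exact₂ _ hT 0)
    (mono_coho_map_mor₁ _ hT (-1) 0 rfl hZ) (epi_coho_map_mor₂ _ hT 0 1 rfl hX)
  let α := DerivedCategory.singleFunctorCompHomologyFunctorIso H 0
  refine ⟨f, g, zero, ShortComplex.shortExact_of_iso ?_ hS⟩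
  exact ShortComplex.isoMk (α.app X) (α.app Y) (α.app Z) (α.hom.naturality f).symm
    (α.hom.naturality g).symm

end TorsionTilt

namespace TorsionTilt

variable {H : Type u} [Category.{v} H] [Abelian H] [HasDerivedCategory.{w} H]

/-! ### From torsion pairs to t-structures. -/

section Lift

variable (τ : TorsionPair H)

lemma liftAisle_iff (X : DerivedCategory.Bounded H) :
    liftAisle τ X ↔ (tCan H).IsLE X 0 ∧ τ.torsion (coho 0 X) := by
  rw [isLE_iff_isZero_coho]
  rfl

lemma liftCoaisle_iff (X : DerivedCategory.Bounded H) :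
    liftCoaisle τ X ↔ (tCan H).IsGE X (-1) ∧ τ.torsionFree (coho (-1) X) := by
  rw [isGE_iff_isZero_coho]
  rfl

lemma liftCoaisle_shift_one_iff (X : DerivedCategory.Bounded H) :
    liftCoaisle τ (X⟦(1 : ℤ)⟧) ↔ (tCan H).IsGE X 0 ∧ τ.torsionFree (coho 0 X) := by
  rw [liftCoaisle_iff, (tCan H).isGE_shift_iff X 0 1 (-1),
    τ.torsionFree.prop_iff_of_iso (cohoShiftIso X 1 (-1) 0 rfl)]

instance : (liftAisle τ).IsClosedUnderIsomorphisms where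
  of_iso {X Y} e hX := by
    rw [liftAisle_iff] at hX ⊢
    have := hX.1
    exact ⟨(tCan H).isLE_of_iso e 0, τ.torsion.prop_of_iso ((cohoFunctor H 0).mapIso e) hX.2⟩

instance : (liftCoaisle τ).IsClosedUnderIsomorphisms where
  of_iso {X Y} e hX := by
    rw [liftCoaisle_iff] at hX ⊢
    have := hX.1
    exact ⟨(tCan H).isGE_of_iso e (-1),
      τ.torsionFree.prop_of_iso ((cohoFunctor H (-1)).mapIso e) hX.2⟩

lemma liftAisle_of_isLE (X : DerivedCategory.Bounded H) [h : (tCan H).IsLE X (-1)] :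
    liftAisle τ X := by
  rw [liftAisle_iff]
  exact ⟨(tCan H).isLE_of_le X (-1) 0,
    τ.torsion_of_isZero ((isLE_iff_isZero_coho X (-1)).1 h 0 (by lia))⟩

lemma liftCoaisle_of_isGE (X : DerivedCategory.Bounded H) [h : (tCan H).IsGE X 0] :
    liftCoaisle τ X := by
  rw [liftCoaisle_iff]
  exact ⟨(tCan H).isGE_of_ge X (-1) 0,
    τ.torsionFree_of_isZero ((isGE_iff_isZero_coho X 0).1 h (-1) (by lia))⟩

/-- Degree reasons make `f` factor as `X → H⁰(X) → H⁰(Y) → Y`, and the middle map goes from a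
torsion object to a torsion-free one. -/
lemma eq_zero_of_liftAisle_of_liftCoaisle_shift {X Y : DerivedCategory.Bounded H} (f : X ⟶ Y)
    (hX : liftAisle τ X) (hY : liftCoaisle τ (Y⟦(1 : ℤ)⟧)) : f = 0 := by
  rw [liftAisle_iff] at hX
  rw [liftCoaisle_shift_one_iff] at hY
  obtain ⟨_, hX⟩ := hX
  obtain ⟨_, hY⟩ := hY
  obtain ⟨A, a, p, _, _, hA⟩ := exists_triangle_of_isLE_zero X
  obtain ⟨B, i, b, _, _, hB⟩ := exists_triangle_of_isGE_zero Y
  obtain ⟨f', rfl⟩ := Triangle.yoneda_exact₂ _ hA f ((tCan H).zero (a ≫ f) (-1) 0)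
  obtain ⟨f'', hf''⟩ := Triangle.coyoneda_exact₂ _ hB f'
    ((tCan H).zero (X := stalk (coho 0 X)) (f' ≫ b) 0 1)
  obtain ⟨g, rfl⟩ := (stalkFunctor H).map_surjective f''
  have hg : (stalkFunctor H).map g = 0 := by rw [τ.hom_eq_zero hX hY g, Functor.map_zero]
  have hf' : f' = 0 := hf''.trans ((congrArg (· ≫ i) hg).trans zero_comp)
  exact (congrArg (p ≫ ·) hf').trans comp_zero

lemma exists_triangle_liftAisle_liftCoaisle (X : DerivedCategory.Bounded H) :
    ∃ (U V : DerivedCategory.Bounded H) (_ : liftAisle τ U) (_ : liftCoaisle τ (V⟦(1 : ℤ)⟧))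
      (f : U ⟶ X) (g : X ⟶ V) (h : V ⟶ U⟦(1 : ℤ)⟧), Triangle.mk f g h ∈ distTriang _ := by
  obtain ⟨A, W, hA, hW, u, v, w, hAXW⟩ := (tCan H).exists_triangle_zero_one X
  have : (tCan H).IsLE A 0 := ⟨hA⟩
  have hW' : (tCan H).IsGE W 1 := ⟨hW⟩
  obtain ⟨C, c, p, d, _, hC⟩ := exists_triangle_of_isLE_zero A
  obtain ⟨T, Z, i, q, zero, hT, hZ, hS⟩ := τ.exists_shortExact (coho 0 A)
  obtain ⟨δ, hδ⟩ := exists_distinguished_stalk _ hS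
  obtain ⟨U, a, b, hU⟩ := distinguished_cocone_triangle₁ (p ≫ (stalkFunctor H).map q)
  obtain ⟨V, y, z, hV⟩ := distinguished_cocone_triangle (a ≫ u)
  -- `o₁` gives a triangle `C[1] → U[1] → T[1]`, whence `H⁰(U) ≅ T`; `o₂` gives `Z → V → W`, whence
  -- `H⁰(V) ≅ Z`.
  have o₁ := someOctahedron rfl (rot_of_distTriang _ hC) (rot_of_distTriang _ hδ)
    (rot_of_distTriang _ hU)
  have o₂ := someOctahedron rfl hU hAXW hV
  have hC₁ : (tCan H).IsLE (C⟦(1 : ℤ)⟧) (-2) := (tCan H).isLE_shift C (-1) 1 (-2)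
  have hT₁ : (tCan H).IsLE ((stalk T)⟦(1 : ℤ)⟧) (-1) := (tCan H).isLE_shift (stalk T) 0 1 (-1)
  have hU₁ : (tCan H).IsLE (U⟦(1 : ℤ)⟧) (-1) :=
    (tCan H).isLE₂ _ o₁.mem (-1) ((tCan H).isLE_of_le (C⟦(1 : ℤ)⟧) (-2) (-1)) hT₁
  obtain ⟨e₁⟩ := nonempty_coho_iso_of_isLE _ o₁.mem (-2) (-1) rfl hC₁
  obtain ⟨e₂⟩ := nonempty_coho_iso_of_isGE _ o₂.mem 0 1 rfl hW'
  refine ⟨U, V, (liftAisle_iff τ U).2 ⟨(tCan H).isLE_of_shift U 0 1 (-1), ?_⟩,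
    (liftCoaisle_shift_one_iff τ V).2 ⟨?_, ?_⟩, _, _, _, hV⟩
  · exact τ.torsion.prop_of_iso ((cohoStalkIso T).symm ≪≫
      (cohoShiftIso (stalk T) 1 (-1) 0 rfl).symm ≪≫ e₁.symm ≪≫ cohoShiftIso U 1 (-1) 0 rfl) hT
  · exact (tCan H).isGE₂ _ o₂.mem 0 (inferInstanceAs ((tCan H).IsGE (stalk Z) 0))
      ((tCan H).isGE_of_ge W 0 1)
  · exact τ.torsionFree.prop_of_iso ((cohoStalkIso Z).symm ≪≫ e₂) hZ

/-- The t-structure lifted from a torsion pair. -/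
noncomputable def liftTStructure : TStructure (DerivedCategory.Bounded H) where
  le n := (liftAisle τ).shift n
  ge n := (liftCoaisle τ).shift n
  le_shift n a n' h X hX :=
    (liftAisle τ).prop_of_iso ((shiftFunctorAdd' _ a n' n h).app X) hX
  ge_shift n a n' h X hX :=
    (liftCoaisle τ).prop_of_iso ((shiftFunctorAdd' _ a n' n h).app X) hX
  zero' X Y f hX hY := eq_zero_of_liftAisle_of_liftCoaisle_shift τ f
    ((liftAisle τ).prop_of_iso ((shiftFunctorZero _ ℤ).app X) hX) hY
  le_zero_le X hX := by
    have := ((liftAisle_iff τ X).1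
      ((liftAisle τ).prop_of_iso ((shiftFunctorZero _ ℤ).app X) hX)).1
    have := (tCan H).isLE_shift X 0 1 (-1)
    exact liftAisle_of_isLE τ (X⟦(1 : ℤ)⟧)
  ge_one_le X hX := by
    have := ((liftCoaisle_shift_one_iff τ X).1 hX).1
    exact (liftCoaisle τ).prop_of_iso ((shiftFunctorZero _ ℤ).symm.app X)
      (liftCoaisle_of_isGE τ X)
  exists_triangle_zero_one X := by
    obtain ⟨U, V, hU, hV, f, g, h, hT⟩ := exists_triangle_liftAisle_liftCoaisle τ X
    exact ⟨U, V, (liftAisle τ).prop_of_iso ((shiftFunctorZero _ ℤ).symm.app U) hU,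
      hV, f, g, h, hT⟩

lemma isLift_liftTStructure : IsLift τ (liftTStructure τ) where
  le_zero_eq := by
    ext X
    exact (liftAisle τ).prop_iff_of_iso ((shiftFunctorZero _ ℤ).app X)
  ge_zero_eq := by
    ext X
    exact (liftCoaisle τ).prop_iff_of_iso ((shiftFunctorZero _ ℤ).app X)

lemma rightOrthogonal_liftTStructure_le_zero_iff (X : DerivedCategory.Bounded H) :
    ((liftTStructure τ).le 0).rightOrthogonal X ↔
      (tCan H).IsGE X 0 ∧ τ.torsionFree (coho 0 X) := by
  rw [(liftTStructure τ).rightOrthogonal_le_eq_ge 0 1 rfl]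
  exact liftCoaisle_shift_one_iff τ X

lemma isTrace_liftTStructure : IsTrace (liftTStructure τ) τ where
  torsion_iff M := by
    rw [(isLift_liftTStructure τ).le_zero_eq, liftAisle_iff,
      τ.torsion.prop_iff_of_iso (cohoStalkIso M)]
    exact ⟨fun h => ⟨inferInstance, h⟩, fun h => h.2⟩
  torsionFree_iff M := by
    rw [rightOrthogonal_liftTStructure_le_zero_iff,
      τ.torsionFree.prop_iff_of_iso (cohoStalkIso M)]
    exact ⟨fun h => ⟨inferInstance, h⟩, fun h => h.2⟩

lemma isIntermediate_liftTStructure : IsIntermediate (liftTStructure τ) where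
  shift_one_mem M := by
    rw [(isLift_liftTStructure τ).le_zero_eq]
    have := (tCan H).isLE_shift (stalk M) 0 1 (-1)
    exact liftAisle_of_isLE τ _
  shift_neg_one_mem M := by
    rw [rightOrthogonal_liftTStructure_le_zero_iff]
    have h := (tCan H).isGE_shift (stalk M) 0 (-1) 1
    exact ⟨(tCan H).isGE_of_ge _ 0 1,
      τ.torsionFree_of_isZero ((isGE_iff_isZero_coho _ 1).1 h 0 (by lia))⟩

end Lift

/-! ### From intermediate t-structures to torsion pairs. -/

section Trace

lemma exists_iso_stalk_shift (X : DerivedCategory.Bounded H) (n m : ℤ) (h : n + m = 0)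
    [h₁ : (tCan H).IsLE X n] [h₂ : (tCan H).IsGE X n] :
    ∃ M : H, Nonempty ((stalk M)⟦m⟧ ≅ X) := by
  have := (tCan H).isLE_shift X n n 0
  have := (tCan H).isGE_shift X n n 0
  obtain ⟨M, ⟨e⟩⟩ := exists_iso_stalk (X⟦n⟧)
  exact ⟨M, ⟨(shiftFunctor _ m).mapIso e.symm ≪≫ (shiftFunctorCompIsoId _ n m h).app X⟩⟩

variable {s : TStructure (DerivedCategory.Bounded H)}

namespace IsIntermediate

/-- Induction on `k` for `X` in degrees `[-k, -1]`: the lowest cohomology splits off as a stalk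
`M[k+1]`, which lies in the aisle because `M[1]` does and aisles are stable under positive shifts.
-/
lemma le_zero_of_isLE (hs : IsIntermediate s) (X : DerivedCategory.Bounded H)
    [hX : (tCan H).IsLE X (-1)] : s.IsLE X 0 := by
  obtain ⟨m, hm⟩ := exists_isGE X
  obtain ⟨k, hk⟩ : ∃ k : ℕ, -(k : ℤ) ≤ m := ⟨m.natAbs, by lia⟩
  replace hm := (tCan H).isGE_of_ge X (-k) m
  clear hk
  induction k generalizing X with
  | zero =>
    -- For `k = 0` the range of degrees is empty and `X` is zero.
    rw [s.isLE_iff_orthogonal 0 1 rfl]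
    exact fun Y f _ => ((tCan H).isZero X (-1) (-(0 : ℕ))).eq_of_src _ _
  | succ k ih =>
    refine s.isLE₂ _ ((tCan H).triangleLTGE_distinguished (-(k : ℤ)) X) 0 ?_ ?_
    · have : (tCan H).IsGE (((tCan H).truncLT (-(k : ℤ))).obj X) (-(k + 1 : ℕ)) := inferInstance
      have : (tCan H).IsLE (((tCan H).truncLT (-(k : ℤ))).obj X) (-(k + 1 : ℕ)) :=
        (tCan H).isLE_truncLT_obj ..
      obtain ⟨M, ⟨e⟩⟩ := exists_iso_stalk_shift (((tCan H).truncLT (-(k : ℤ))).obj X)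
        (-(k + 1 : ℕ)) (k + 1 : ℕ) (by lia)
      have hM : s.IsLE ((stalk M)⟦(1 : ℤ)⟧) 0 := ⟨hs.shift_one_mem M⟩
      have := (s.isLE_shift_iff (stalk M) 1 1 0).1 hM
      have := s.isLE_shift (stalk M) 1 (k + 1 : ℕ) (-k)
      have := s.isLE_of_iso e (-k)
      exact s.isLE_of_le (((tCan H).truncLT (-(k : ℤ))).obj X) (-k) 0
    · have h : (tCan H).IsLE (((tCan H).truncGE (-(k : ℤ))).obj X) (-1) := inferInstance
      have : (tCan H).IsGE (((tCan H).truncGE (-(k : ℤ))).obj X) (-(k : ℤ)) := inferInstance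
      exact ih _ (hX := h) ‹_›

/-- Dual induction, on degrees `[1, k]`, removing the top cohomology. -/
lemma ge_one_of_isGE (hs : IsIntermediate s) (X : DerivedCategory.Bounded H)
    [hX : (tCan H).IsGE X 1] : s.IsGE X 1 := by
  obtain ⟨m, hm⟩ := exists_isLE X
  obtain ⟨k, hk⟩ : ∃ k : ℕ, m ≤ (k : ℤ) := ⟨m.natAbs, by lia⟩
  replace hm := (tCan H).isLE_of_le X m k
  clear hk
  induction k generalizing X with
  | zero =>
    rw [s.isGE_iff_orthogonal 0 1 rfl]
    exact fun Y f _ => ((tCan H).isZero X (0 : ℕ) 1).eq_of_tgt _ _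
  | succ k ih =>
    refine s.isGE₂ _ ((tCan H).triangleLTGE_distinguished (k + 1 : ℕ) X) 1 ?_ ?_
    · have h : (tCan H).IsGE (((tCan H).truncLT (k + 1 : ℕ)).obj X) 1 := inferInstance
      have : (tCan H).IsLE (((tCan H).truncLT (k + 1 : ℕ)).obj X) k :=
        (tCan H).isLE_truncLT_obj ..
      exact ih _ (hX := h) ‹_›
    · have : (tCan H).IsLE (((tCan H).truncGE (k + 1 : ℕ)).obj X) (k + 1 : ℕ) := inferInstance
      have : (tCan H).IsGE (((tCan H).truncGE (k + 1 : ℕ)).obj X) (k + 1 : ℕ) := inferInstance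
      obtain ⟨M, ⟨e⟩⟩ := exists_iso_stalk_shift (((tCan H).truncGE (k + 1 : ℕ)).obj X)
        (k + 1 : ℕ) (-(k + 1 : ℕ)) (by lia)
      have hM : s.ge 1 ((stalk M)⟦(-1 : ℤ)⟧) := by
        rw [← s.rightOrthogonal_le_eq_ge 0 1 rfl]
        exact hs.shift_neg_one_mem M
      have := (s.isGE_shift_iff (stalk M) 0 (-1) 1).1 ⟨hM⟩
      have := s.isGE_shift (stalk M) 0 (-(k + 1 : ℕ)) (k + 1 : ℕ)
      have := s.isGE_of_iso e (k + 1 : ℕ)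
      exact s.isGE_of_ge (((tCan H).truncGE (k + 1 : ℕ)).obj X) 1 (k + 1 : ℕ)

lemma isLE_zero_of_le (hs : IsIntermediate s) (X : DerivedCategory.Bounded H)
    (hX : s.le 0 X) : (tCan H).IsLE X 0 := by
  rw [(tCan H).isLE_iff_orthogonal 0 1 rfl]
  exact fun Y f _ => s.zero' f hX (hs.ge_one_of_isGE Y).ge

lemma isGE_zero_of_ge (hs : IsIntermediate s) (X : DerivedCategory.Bounded H)
    (hX : s.ge 1 X) : (tCan H).IsGE X 0 := by
  rw [(tCan H).isGE_iff_orthogonal (-1) 0 rfl]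
  exact fun Y f _ => s.zero' f (hs.le_zero_of_isLE Y).le hX

lemma exists_shortExact (hs : IsIntermediate s) (Y : H) :
    ∃ (X Z : H) (f : X ⟶ Y) (g : Y ⟶ Z) (zero : f ≫ g = 0),
      s.le 0 (stalk X) ∧ s.ge 1 (stalk Z) ∧ (ShortComplex.mk f g zero).ShortExact := by
  obtain ⟨U, V, hU, hV, a, b, c, hT⟩ := s.exists_triangle_zero_one (stalk Y)
  have := hs.isLE_zero_of_le U hU
  have := hs.isGE_zero_of_ge V hV
  -- `U` is an extension of `Y` and `V[-1]`, and `V` one of `U[1]` and `Y`; these bounds put both in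
  -- the canonical heart.
  have : (tCan H).IsGE U 0 := by
    have := (tCan H).isGE_shift V 0 (-1) 1
    exact (tCan H).isGE₂ _ (inv_rot_of_distTriang _ hT) 0
      ((tCan H).isGE_of_ge (V⟦(-1 : ℤ)⟧) 0 1) (inferInstanceAs ((tCan H).IsGE (stalk Y) 0))
  have : (tCan H).IsLE V 0 := by
    have := (tCan H).isLE_shift U 0 1 (-1)
    exact (tCan H).isLE₂ _ (rot_of_distTriang _ hT) 0
      (inferInstanceAs ((tCan H).IsLE (stalk Y) 0)) ((tCan H).isLE_of_le (U⟦(1 : ℤ)⟧) (-1) 0)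
  obtain ⟨X, ⟨e⟩⟩ := exists_iso_stalk U
  obtain ⟨Z, ⟨e'⟩⟩ := exists_iso_stalk V
  have hT' := distinguished_of_iso₃ (distinguished_of_iso₁ hT e) e'
  obtain ⟨f, g, zero, hS⟩ := exists_shortExact_of_distinguished_stalk _ _ _ hT'
  exact ⟨X, Z, f, g, zero, (s.le 0).prop_of_iso e hU, (s.ge 1).prop_of_iso e' hV, hS⟩

end IsIntermediate

/-- The trace on `H` of an intermediate t-structure. -/
noncomputable def traceTorsionPair (hs : IsIntermediate s) : TorsionPair H where
  torsion M := s.le 0 (stalk M)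
  torsionFree M := (s.le 0).rightOrthogonal (stalk M)
  torsion_of_iso := ⟨fun e h => (s.le 0).prop_of_iso ((stalkFunctor H).mapIso e) h⟩
  torsionFree_of_iso :=
    ⟨fun e h => (s.le 0).rightOrthogonal.prop_of_iso ((stalkFunctor H).mapIso e) h⟩
  hom_eq_zero _ _ hX hY f := (stalkFunctor H).map_injective
    ((hY ((stalkFunctor H).map f) hX).trans ((stalkFunctor H).map_zero _ _).symm)
  exists_shortExact Y := by
    rw [s.rightOrthogonal_le_eq_ge 0 1 rfl]
    exact hs.exists_shortExact Y

lemma isTrace_traceTorsionPair (hs : IsIntermediate s) : IsTrace s (traceTorsionPair hs) where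
  torsion_iff _ := Iff.rfl
  torsionFree_iff _ := Iff.rfl

/-- Each object of the lifted aisle is an extension of its `H⁰`, in the aisle of `s` by definition
of the trace, by an object of `D^{≤-1}`; dually for the coaisle. -/
lemma liftTStructure_traceTorsionPair (hs : IsIntermediate s) :
    liftTStructure (traceTorsionPair hs) = s := by
  refine TStructure.ext_of_le_zero_of_ge_one (fun X hX => ?_) (fun X hX => ?_)
  · rw [(isLift_liftTStructure _).le_zero_eq, liftAisle_iff] at hX
    obtain ⟨_, hX⟩ := hX
    obtain ⟨C, f, g, h, _, hT⟩ := exists_triangle_of_isLE_zero X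
    exact (s.isLE₂ _ hT 0 (hs.le_zero_of_isLE C) ⟨hX⟩).le
  · replace hX := (liftCoaisle_shift_one_iff _ X).1 hX
    obtain ⟨_, hX⟩ := hX
    obtain ⟨C, f, g, h, _, hT⟩ := exists_triangle_of_isGE_zero X
    replace hX : (s.le 0).rightOrthogonal (stalk (coho 0 X)) := hX
    rw [s.rightOrthogonal_le_eq_ge 0 1 rfl] at hX
    exact (s.isGE₂ _ hT 1 ⟨hX⟩ (hs.ge_one_of_isGE C)).ge

lemma IsTrace.unique {τ τ' : TorsionPair H} (h : IsTrace s τ) (h' : IsTrace s τ') : τ = τ' := by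
  ext M
  · rw [h.torsion_iff, h'.torsion_iff]
  · rw [h.torsionFree_iff, h'.torsionFree_iff]

end Trace

variable (H) in
/-- Torsion pairs in `H` correspond to the intermediate t-structures in `D^b(H)`. -/
noncomputable def torsionPairEquiv :
    TorsionPair H ≃ {s : TStructure (DerivedCategory.Bounded H) // IsIntermediate s} where
  toFun τ := ⟨liftTStructure τ, isIntermediate_liftTStructure τ⟩
  invFun s := traceTorsionPair s.2
  -- Both torsion pairs are traces of the same t-structure `liftTStructure τ`.
  left_inv τ := (isTrace_traceTorsionPair _).unique (isTrace_liftTStructure τ)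
  right_inv s := Subtype.ext (liftTStructure_traceTorsionPair s.2)

end TorsionTilt

theorem proposition2p4 {k : Type t} [Field k] [IsAlgClosed k]
    {H : Type u} [Category.{v} H] [Abelian H] [Linear k H]
    [HasExt.{w'} H] [HasDerivedCategory.{w} H]
    (hH : TorsionTilt.IsHereditary.{w'} k H) :
    ∃ Φ : TorsionTilt.TorsionPair H ≃
        {s : TStructure (DerivedCategory.Bounded H) // TorsionTilt.IsIntermediate s},
      (∀ τ : TorsionTilt.TorsionPair H, TorsionTilt.IsLift τ (Φ τ).1) ∧
      (∀ s : {s : TStructure (DerivedCategory.Bounded H) // TorsionTilt.IsIntermediate s},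
        TorsionTilt.IsTrace s.1 (Φ.symm s)) :=
  ⟨TorsionTilt.torsionPairEquiv H, TorsionTilt.isLift_liftTStructure,
    fun s => TorsionTilt.isTrace_traceTorsionPair s.2⟩
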